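/- Let $R$ be a $2$-adic ring, that is, the integral closure of the ring $\mathbb{Z}_2$ of $2$-adic integers in a finite extension field of $\mathbb{Q}_2$. Let $G$ be a finite group, and let $V(RG)$ be the group of units of augmentation one in the group ring $RG$. For a subset $T$ of $G$ let $R[T]$ denote the $R$-span of $T$ in $RG$, and let $T_2$ be the set of involutions (elements of order $2$) of $G$. Let $c\in G$ and $u\in V(RG)$ be $2$-elements (elements of finite order, the order being a power of $2$) with $c^2=u^2$ and $c^{-1}u=1+2f$ for some $f\in 2RG+R[T_2]+R$. Then $c$ and $u$ are conjugate in the unit group of $RG$: there is a unit $v$ of $RG$ with $u=v^{-1}cv$. -/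

import Mathlib

namespace PadicGroupRing

/-- The augmentation map `RG → R`, sending every `g ∈ G` to `1`. -/
noncomputable def augmentation (R G : Type*) [CommRing R] [Group G] :
    MonoidAlgebra R G →ₐ[R] R :=
  MonoidAlgebra.lift R R G (1 : G →* R)

/-- `V(RG)`: the group of units of augmentation one in `RG`. -/
noncomputable def normalizedUnits (R G : Type*) [CommRing R] [Group G] :
    Subgroup (MonoidAlgebra R G)ˣ :=
  (Units.map (augmentation R G : MonoidAlgebra R G →* R)).ker

/-- The embedding of `G` into the unit group of `RG`. -/
noncomputable def groupUnit (R : Type*) {G : Type*} [CommRing R] [Group G] :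
    G →* (MonoidAlgebra R G)ˣ :=
  (MonoidAlgebra.of R G).toHomUnits

/-- A `p`-element of a group: an element whose order is finite and a power of `p`. -/
def IsPElement (p : ℕ) {H : Type*} [Group H] (h : H) : Prop :=
  ∃ k : ℕ, orderOf h = p ^ k

/-- The set `T₂` of involutions (elements of order exactly two) of `G`. -/
def involutions (G : Type*) [Group G] : Set G :=
  {g | orderOf g = 2}

/-- `R[T]`: the `R`-span in `RG` of the elements of a subset `T` of `G`. -/
noncomputable def spanOf (R : Type*) {G : Type*} [CommRing R] [Group G] (T : Set G) :
    Submodule R (MonoidAlgebra R G) :=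
  Submodule.span R (MonoidAlgebra.of R G '' T)

end PadicGroupRing

/-!
# Conjugacy of `2`-elements in `2`-adic group rings

Write `w = c⁻¹ * u = 1 + 2 * f` and `x ^ c = c⁻¹ * x * c`. Since `c ^ 2 = u ^ 2`, the element
`1 + f` intertwines `c` and `u`, that is `c * (1 + f) = (1 + f) * u`, and so does `x + x ^ c * w`
for every `x` commuting with `c ^ 2`. It is therefore enough to choose `x` so that the intertwiner
`v = 1 + f + x + x ^ c * w` is congruent to `1` modulo `2`: the element `2` lies in the radical of
`R`, so such a `v` is a unit by Nakayama's lemma (`isUnit_one_add_smul_of_mem_jacobson`).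

Expanding `c ^ 2 = u ^ 2` gives `f + f ^ c + 2 * f ^ c * f = 0` and shows that `f` commutes with
`c ^ 2`. So the coefficients of `f` are constant on the `⟨c ^ 2⟩`-classes of `G`, and modulo `2` they
are constant on the `⟨c⟩`-classes. As `c` is a `2`-element, a `⟨c⟩`-class with more than one element
splits into two `⟨c ^ 2⟩`-classes (`Equiv.Perm.exists_alternating_set`). Let `x` be the part of `f`
carried by one of the two in each case; then `f + x + x ^ c` vanishes modulo `2` off the
centralizer of `c`.

At an element `g` centralizing `c`, the relation divided by `2` says that `f` and `f ^ 2` have the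
same coefficient modulo `2`. The hypothesis on `f` says that modulo `2` it is supported on elements
of square one, and for such an element the coefficient of `f ^ 2` at `g` is even: for an involution
`g` the products `h * h' = g` come in pairs, and for `g = 1` one gets the square of the augmentation
of `f`, which is zero (`sum_mul_eq_zero_of_sq_eq_one`). Hence `f` also vanishes modulo `2` at the
centralizer of `c`.
-/

/-! ### The radical of a `2`-adic ring and units of finite algebras over it -/

/-- In the integral closure of `ℤ₂` in a field over it, the element `2` lies in the
Jacobson radical: by integrality every maximal ideal contracts to the maximal ideal of `ℤ₂`. -/
theorem two_mem_jacobson_of_isIntegralClosure {K : Type*} [Field K] [Algebra ℤ_[2] K]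
    {R : Type*} [CommRing R] [Algebra R K] [IsIntegralClosure R ℤ_[2] K] :
    (2 : R) ∈ Ideal.jacobson (⊥ : Ideal R) := by
  have key (a : integralClosure ℤ_[2] K) : IsUnit (1 + 2 * a) := by
    by_contra hu
    obtain ⟨M, hM, haM⟩ := exists_max_ideal_of_mem_nonunits hu
    have hMc := Ideal.isMaximal_comap_of_isIntegral_of_isMaximal (R := ℤ_[2]) M
    have h2 : (2 : ℤ_[2]) ∈ M.comap (algebraMap ℤ_[2] (integralClosure ℤ_[2] K)) := by
      rw [IsLocalRing.eq_maximalIdeal hMc, PadicInt.maximalIdeal_eq_span_p]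
      exact Ideal.mem_span_singleton_self _
    have h2M : (2 : integralClosure ℤ_[2] K) ∈ M := by
      rwa [Ideal.mem_comap, map_ofNat] at h2
    refine hM.ne_top ((Ideal.eq_top_iff_one M).mpr ?_)
    simpa using M.sub_mem haM (M.mul_mem_right a h2M)
  rw [Ideal.mem_jacobson_bot]
  intro r
  have hint : IsIntegral ℤ_[2] (algebraMap R K r) :=
    (IsIntegralClosure.isIntegral_iff (A := R)).mpr ⟨r, rfl⟩
  obtain ⟨b, hb⟩ := (key ⟨_, hint⟩).exists_right_inv
  obtain ⟨s, hs⟩ := (IsIntegralClosure.isIntegral_iff (A := R)).mp b.2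
  refine IsUnit.of_mul_eq_one s (IsIntegralClosure.algebraMap_injective R ℤ_[2] K ?_)
  have hbK := congrArg Subtype.val hb
  simp only [map_mul, map_add, map_one, map_ofNat, hs]
  rw [add_comm]
  exact hbK

/-- In a module-finite algebra, a multiple of an element of the radical of the base ring is
quasi-regular: multiplication by `1 + a • y` is onto by Nakayama's lemma, hence bijective. -/
theorem isUnit_one_add_smul_of_mem_jacobson {R A : Type*} [CommRing R] [Ring A] [Algebra R A]
    [Module.Finite R A] {a : R} (ha : a ∈ Ideal.jacobson (⊥ : Ideal R)) (y : A) :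
    IsUnit (1 + a • y) := by
  set L := LinearMap.mulLeft R (1 + a • y)
  have hsurj : Function.Surjective L := by
    rw [← LinearMap.range_eq_top, eq_top_iff]
    refine Submodule.le_of_le_smul_of_le_jacobson_bot (I := Ideal.span {a}) Module.Finite.fg_top
      ((Ideal.span_singleton_le_iff_mem _).mpr ha) fun z _ ↦ ?_
    have hz : z = (1 + a • y) * z + a • (-(y * z)) := by
      rw [add_mul, one_mul, smul_mul_assoc, smul_neg]; abel
    rw [hz]
    exact Submodule.add_mem_sup ⟨z, rfl⟩
      (Submodule.smul_mem_smul (Ideal.mem_span_singleton_self a) trivial)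
  have hinj : Function.Injective L := OrzechProperty.injective_of_surjective_endomorphism L hsurj
  obtain ⟨b, hb⟩ := hsurj 1
  have hb : (1 + a • y) * b = 1 := hb
  refine ⟨⟨1 + a • y, b, hb, hinj ?_⟩, rfl⟩
  change (1 + a • y) * (b * (1 + a • y)) = (1 + a • y) * 1
  rw [← mul_assoc, hb, one_mul, mul_one]

/-! ### Permutations of `2`-power order -/

/-- A permutation of `2`-power order admits a set that contains every other point along each of
its nontrivial cycles. -/
theorem Equiv.Perm.exists_alternating_set {α : Type*} (σ : Equiv.Perm α) {k : ℕ}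
    (hσ : σ ^ 2 ^ k = 1) :
    ∃ A : Set α, (∀ g, σ (σ g) ∈ A ↔ g ∈ A) ∧ ∀ g, σ g ≠ g → (σ g ∈ A ↔ g ∉ A) := by
  let s := Equiv.Perm.SameCycle.setoid σ
  let rep (g : α) : α := (Quotient.mk s g).out
  have hrep (g : α) : ∃ n : ℤ, (σ ^ n) (rep g) = g := Quotient.mk_out (s := s) g
  have hrep1 (g : α) : rep (σ g) = rep g := by
    refine congrArg Quotient.out (Quotient.sound (s := s) ?_)
    exact Equiv.Perm.sameCycle_apply_left.mpr (Equiv.Perm.SameCycle.refl σ g)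
  have hcomp (m n : ℤ) (g : α) : (σ ^ m) ((σ ^ n) g) = (σ ^ (m + n)) g := by
    rw [zpow_add, Equiv.Perm.mul_apply]
  -- An odd power of `σ` generates the same group as `σ`.
  have hodd (m : ℤ) (hm : Odd m) (g : α) (h : (σ ^ m) g = g) : σ g = g := by
    have hcop : IsCoprime m ((2 ^ k : ℕ) : ℤ) := by
      push_cast
      exact (Int.isCoprime_two_right.mpr hm).pow_right
    obtain ⟨a, b, hab⟩ := hcop
    have h1 : σ = (σ ^ m) ^ a := by
      rw [← zpow_mul, mul_comm, eq_sub_of_add_eq hab, zpow_sub, zpow_one, mul_comm b, zpow_mul,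
        zpow_natCast, hσ, one_zpow, inv_one, mul_one]
    rw [h1]
    exact Equiv.Perm.zpow_apply_eq_self_of_apply_eq_self h a
  refine ⟨{g | ∃ n : ℤ, Even n ∧ (σ ^ n) (rep g) = g}, fun g ↦ ?_, fun g hg ↦ ?_⟩
  · simp only [Set.mem_ofPred_eq, hrep1]
    constructor
    · rintro ⟨n, hn, h⟩
      refine ⟨-2 + n, by simpa [parity_simps] using hn, ?_⟩
      rw [← hcomp, h, zpow_neg, Equiv.Perm.inv_eq_iff_eq]
      rfl
    · rintro ⟨n, hn, h⟩
      refine ⟨2 + n, by simpa [parity_simps] using hn, ?_⟩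
      rw [← hcomp, h]
      rfl
  · simp only [Set.mem_ofPred_eq, hrep1]
    constructor
    · rintro ⟨m, hm, h⟩ ⟨n, hn, h'⟩
      refine hg (hodd (n - m + 1) (by simp [parity_simps, hm, hn]) g ?_)
      rw [← hcomp, zpow_one, ← h, hcomp, sub_add_cancel, h']
    · intro h
      obtain ⟨n, hn⟩ := hrep g
      have hne : Odd n := Int.not_even_iff_odd.mp fun he ↦ h ⟨n, he, hn⟩
      refine ⟨1 + n, by simpa [parity_simps] using hne, ?_⟩
      rw [← hcomp, hn, zpow_one]

/-! ### Squares in characteristic two -/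

/-- In characteristic two, let `F` be an element of augmentation zero of a group ring, supported on
elements of square one. Then its square has zero coefficient at every such element `g`: for
`g ≠ 1`, the terms `F h * F h'` with `h * h' = g` cancel in pairs because `h` and `h'` commute,
and for `g = 1` the coefficient is the square of the augmentation. -/
theorem sum_mul_eq_zero_of_sq_eq_one {S G : Type*} [CommRing S] [CharP S 2] [Group G] [Fintype G]
    (F : G → S) (hF : ∀ h, h ^ 2 ≠ 1 → F h = 0) (hsum : ∑ h, F h = 0) (g : G) (hg : g ^ 2 = 1) :
    ∑ h, F h * F (h⁻¹ * g) = 0 := by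
  classical
  have hinv (h : G) (hh : h ^ 2 = 1) : h⁻¹ = h := inv_eq_of_mul_eq_one_right (by rwa [← sq])
  have hne (h : G) (hh : F h ≠ 0) : h ^ 2 = 1 := by_contra fun h' ↦ hh (hF h h')
  by_cases hg1 : g = 1
  · have : ∀ h, F h * F (h⁻¹ * g) = F h ^ 2 := fun h ↦ by
      by_cases hh : h ^ 2 = 1
      · rw [hg1, mul_one, hinv h hh, sq]
      · simp [hF h hh]
    rw [Finset.sum_congr rfl fun h _ ↦ this h, ← CharTwo.sum_sq, hsum, sq, zero_mul]
  -- Where the term is nonzero, `h` and `h' = h⁻¹ * g` are their own inverses, and so is `g`.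
  have hswap (h : G) (hh : F h * F (h⁻¹ * g) ≠ 0) : (h⁻¹ * g)⁻¹ * g = h := by
    have h1 := hinv _ (hne _ (left_ne_zero_of_mul hh))
    have h2 := hinv _ (hne _ (right_ne_zero_of_mul hh))
    have h3 := hinv g hg
    calc (h⁻¹ * g)⁻¹ * g = (h⁻¹ * g) * g⁻¹ := by rw [h2, h3]
      _ = h := by rw [mul_inv_cancel_right, h1]
  refine Finset.sum_involution
    (fun h _ ↦ if F h * F (h⁻¹ * g) = 0 then h else h⁻¹ * g) ?_ ?_ ?_ ?_
  · intro h _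
    split_ifs with h0
    · rw [h0, add_zero]
    · rw [hswap h h0, mul_comm, CharTwo.add_self_eq_zero]
  · intro h _ h0 heq
    rw [if_neg h0] at heq
    have h1 := hne _ (left_ne_zero_of_mul h0)
    exact hg1 (by rw [inv_mul_eq_iff_eq_mul.mp heq, ← sq, h1])
  · intro h _
    exact Finset.mem_univ _
  · intro h _
    by_cases h0 : F h * F (h⁻¹ * g) = 0
    · simp [h0]
    · have h0' : F (h⁻¹ * g) * F h ≠ 0 := by rwa [mul_comm]
      simp only [if_neg h0, hswap h h0, if_neg h0']

/-! ### Coefficients in the group ring -/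

namespace PadicGroupRing

section

variable {R G : Type*} [CommRing R] [Group G]

/-- Modulo `2`, an element of `2RG + R[T₂] + R` is supported on the elements of square one. -/
theorem two_dvd_coeff_of_sq_ne_one {f a t : MonoidAlgebra R G} {r : R}
    (ht : t ∈ spanOf R (involutions G))
    (hf : f = 2 * a + t + algebraMap R (MonoidAlgebra R G) r) {g : G} (hg : g ^ 2 ≠ 1) :
    (2 : R) ∣ f.coeff g := by
  have ht0 : t.coeff g = 0 := by
    clear hf
    induction ht using Submodule.span_induction with
    | mem x hx =>
      obtain ⟨s, hs, rfl⟩ := hx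
      have hsg : s ≠ g := by
        rintro rfl
        exact hg (by rw [← (show orderOf s = 2 from hs), pow_orderOf_eq_one])
      simp [MonoidAlgebra.of_apply, hsg]
    | zero => simp
    | add x y _ _ hx hy => simp [hx, hy]
    | smul b x _ hx => simp [hx]
  have hg1 : (1 : G) ≠ g := by
    rintro rfl
    exact hg (one_pow 2)
  refine ⟨a.coeff g, ?_⟩
  simp [hf, ht0, hg1, two_mul, MonoidAlgebra.coe_algebraMap]

theorem augmentation_eq_sum [Fintype G] (f : MonoidAlgebra R G) :
    augmentation R G f = ∑ g, f.coeff g := by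
  rw [augmentation, MonoidAlgebra.lift_apply, Finsupp.sum_fintype _ _ (by simp)]
  simp

theorem coeff_mul_eq_sum [Fintype G] (f f' : MonoidAlgebra R G) (g : G) :
    (f * f').coeff g = ∑ h, f.coeff h * f'.coeff (h⁻¹ * g) := by
  rw [MonoidAlgebra.coeff_mul_apply_left, Finsupp.sum_fintype _ _ (by simp)]

theorem coeff_two_mul (f : MonoidAlgebra R G) (g : G) :
    (2 * f).coeff g = 2 * f.coeff g := by
  simp [two_mul]

/-- Conjugating by `c` permutes the coefficients through the inner automorphism of `c`. -/
theorem coeff_groupUnit_inv_mul_mul (c : G) (f : MonoidAlgebra R G) (g : G) :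
    (((groupUnit R c)⁻¹ : (MonoidAlgebra R G)ˣ) * f * groupUnit R c : MonoidAlgebra R G).coeff g
      = f.coeff (MulAut.conj c g) := by
  have h1 : ((groupUnit R c : (MonoidAlgebra R G)ˣ) : MonoidAlgebra R G)
      = MonoidAlgebra.single c 1 := rfl
  have h2 : (((groupUnit R c)⁻¹ : (MonoidAlgebra R G)ˣ) : MonoidAlgebra R G)
      = MonoidAlgebra.single c⁻¹ 1 := rfl
  simp [h1, h2, mul_assoc]

/-- The coefficients of a square modulo `2`: if `f` is modulo `2` supported on elements of square
one and of even augmentation, then `f ^ 2` has even coefficients at all such elements. -/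
theorem two_dvd_coeff_mul_self [Finite G] [Nontrivial R]
    (hJ : (2 : R) ∈ Ideal.jacobson (⊥ : Ideal R)) {f : MonoidAlgebra R G}
    (hf : ∀ g : G, g ^ 2 ≠ 1 → (2 : R) ∣ f.coeff g) (haug : (2 : R) ∣ augmentation R G f)
    {g : G} (hg : g ^ 2 = 1) : (2 : R) ∣ (f * f).coeff g := by
  have := Fintype.ofFinite G
  have hnon : ((2 : ℕ) : R) ∈ nonunits R := fun hu ↦ by
    obtain ⟨b, hb⟩ := hu.exists_right_inv
    have h0 := Ideal.mem_jacobson_bot.mp hJ (-b)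
    rw [mul_neg, show (2 : R) * b = 1 from hb, neg_add_cancel] at h0
    exact not_isUnit_zero h0
  have := CharP.quotient R 2 hnon
  rw [augmentation_eq_sum] at haug
  rw [coeff_mul_eq_sum]
  rw [← Ideal.mem_span_singleton, ← Ideal.Quotient.eq_zero_iff_mem] at haug ⊢
  rw [map_sum] at haug ⊢
  simp only [map_mul]
  refine sum_mul_eq_zero_of_sq_eq_one _ (fun h hh ↦ ?_) haug g hg
  exact Ideal.Quotient.eq_zero_iff_mem.mpr (Ideal.mem_span_singleton.mpr (hf h hh))

/-! ### Conjugacy -/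

/-- The conjugacy theorem over any domain with `2 ≠ 0` in its Jacobson radical. -/
theorem exists_conj_of_inv_mul_eq_one_add_two_mul [Finite G] [IsDomain R] (h2 : (2 : R) ≠ 0)
    (hJ : (2 : R) ∈ Ideal.jacobson (⊥ : Ideal R)) {c : G} (hc : IsPElement 2 c)
    {u : (MonoidAlgebra R G)ˣ} (huV : u ∈ normalizedUnits R G)
    (hsq : groupUnit R c ^ 2 = u ^ 2) {f : MonoidAlgebra R G}
    (hcu : (((groupUnit R c)⁻¹ * u : (MonoidAlgebra R G)ˣ) : MonoidAlgebra R G) = 1 + 2 * f)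
    (hf : ∀ g : G, g ^ 2 ≠ 1 → (2 : R) ∣ f.coeff g) :
    ∃ v : (MonoidAlgebra R G)ˣ, u = v⁻¹ * groupUnit R c * v := by
  have htwo {x y : MonoidAlgebra R G} (h : 2 * x = 2 * y) : x = y := by
    ext g
    have := congrArg (fun z ↦ z.coeff g) h
    simp only [coeff_two_mul] at this
    exact mul_left_cancel₀ h2 this
  set C : (MonoidAlgebra R G)ˣ := groupUnit R c with hC
  set γ : MonoidAlgebra R G := (C : MonoidAlgebra R G) with hγ
  set γ' : MonoidAlgebra R G := ((C⁻¹ : (MonoidAlgebra R G)ˣ) : MonoidAlgebra R G) with hγ'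
  have hγγ' : γ * γ' = 1 := C.mul_inv
  have hγ'γ : γ' * γ = 1 := C.inv_mul
  have hu : (u : MonoidAlgebra R G) = γ * (1 + 2 * f) := by
    rw [← hcu, Units.val_mul, ← mul_assoc, hγγ', one_mul]
  have hsq' : γ * γ = u * u := by
    have := congrArg Units.val hsq
    simpa [sq] using this
  -- Both `c` and `u` have augmentation one, and `2` can be cancelled in `R`.
  have haug : augmentation R G f = 0 := by
    have hu1 : augmentation R G u = 1 := congrArg Units.val huV
    have hc1 : augmentation R G γ = 1 := by
      rw [hγ, hC]
      change augmentation R G (MonoidAlgebra.single c 1) = 1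
      simp [augmentation]
    rw [hu, map_mul, hc1, one_mul, map_add, map_one, map_mul, map_ofNat, add_eq_left] at hu1
    exact (mul_eq_zero.mp hu1).resolve_left h2
  set w : MonoidAlgebra R G := 1 + 2 * f with hw
  have hwγw : w * γ * w = γ := by
    calc w * γ * w = γ' * ((γ * w) * (γ * w)) := by
          simp only [← mul_assoc, hγ'γ, one_mul]
      _ = γ := by rw [← hu, ← hsq', ← mul_assoc, hγ'γ, one_mul]
  -- The relation `f + f ^ c + 2 * f ^ c * f = 0`, with `f ^ c = c⁻¹ * f * c`.
  have hrel : f + γ' * f * γ + 2 * (γ' * f * γ * f) = 0 := by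
    have h1 : γ' * w * γ * w = 1 := by
      rw [mul_assoc, mul_assoc, ← mul_assoc w, hwγw, hγ'γ]
    have h3 : γ' * w * γ = 1 + 2 * (γ' * f * γ) := by
      calc γ' * w * γ = γ' * γ + 2 * (γ' * f * γ) := by rw [hw]; noncomm_ring
        _ = 1 + 2 * (γ' * f * γ) := by rw [hγ'γ]
    rw [h3] at h1
    refine htwo ?_
    calc 2 * (f + γ' * f * γ + 2 * (γ' * f * γ * f))
        = (1 + 2 * (γ' * f * γ)) * w - 1 := by rw [hw]; noncomm_ring
      _ = 2 * 0 := by rw [h1, sub_self, mul_zero]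
  have hcomm : f * (γ * γ) = γ * γ * f := by
    have h1 : w * (γ * γ) = γ * γ * w := by
      calc w * (γ * γ) = w * γ * (w * γ * w) := by rw [hwγw, mul_assoc]
        _ = w * γ * w * (γ * w) := by simp only [mul_assoc]
        _ = γ * γ * w := by rw [hwγw, mul_assoc]
    refine htwo ?_
    calc 2 * (f * (γ * γ)) = w * (γ * γ) - γ * γ := by rw [hw]; noncomm_ring
      _ = γ * γ * w - γ * γ := by rw [h1]
      _ = 2 * (γ * γ * f) := by rw [hw]; noncomm_ring
  set σ : Equiv.Perm G := MulAut.toPerm G (MulAut.conj c) with hσ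
  have hconj (x : MonoidAlgebra R G) (g : G) : (γ' * x * γ).coeff g = x.coeff (σ g) :=
    coeff_groupUnit_inv_mul_mul c x g
  have hfσσ (g : G) : f.coeff (σ (σ g)) = f.coeff g := by
    rw [← hconj, ← hconj]
    congr 2
    calc γ' * (γ' * f * γ) * γ = γ' * (γ' * (f * (γ * γ))) := by simp only [mul_assoc]
      _ = f := by
        rw [hcomm, mul_assoc γ, ← mul_assoc γ' γ, hγ'γ, one_mul, ← mul_assoc, hγ'γ, one_mul]
  have hfσ (g : G) : (2 : R) ∣ f.coeff g + f.coeff (σ g) := by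
    have h := congrArg (fun z ↦ z.coeff g) hrel
    simp only [MonoidAlgebra.coeff_add, Finsupp.add_apply, coeff_two_mul, hconj] at h
    exact ⟨_, (eq_neg_of_add_eq_zero_left h).trans (mul_neg _ _).symm⟩
  -- At the centralizer of `c`, dividing the relation by `2` gives `f ≡ f * f` modulo `2`.
  have hfix (g : G) (hg : σ g = g) : (2 : R) ∣ f.coeff g := by
    by_cases hg2 : g ^ 2 = 1
    · have h := congrArg (fun z ↦ z.coeff g) hrel
      simp only [MonoidAlgebra.coeff_add, Finsupp.add_apply, coeff_two_mul, hconj, hg,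
        ← two_mul, ← mul_add] at h
      have h0 : f.coeff g + (γ' * f * γ * f).coeff g = 0 :=
        (mul_eq_zero.mp h).resolve_left h2
      have hp : γ' * f * γ * f = -(f * f) - 2 * (γ' * f * γ * f * f) := by
        have h1 := congrArg (· * f) hrel
        simp only [zero_mul, add_mul] at h1
        rw [mul_assoc 2] at h1
        rw [eq_sub_iff_add_eq, eq_neg_iff_add_eq_zero, ← h1]
        abel
      rw [hp] at h0
      simp only [MonoidAlgebra.coeff_sub, MonoidAlgebra.coeff_neg, Finsupp.sub_apply,
        Finsupp.neg_apply, coeff_two_mul] at h0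
      have h1 : f.coeff g = (f * f).coeff g + 2 * (γ' * f * γ * f * f).coeff g := by
        linear_combination h0
      rw [h1]
      exact dvd_add (two_dvd_coeff_mul_self hJ hf (haug ▸ dvd_zero _) hg2) (dvd_mul_right _ _)
    · exact hf g hg2
  obtain ⟨k, hk⟩ := hc
  obtain ⟨A, hAA, hA⟩ := σ.exists_alternating_set (k := k) (by
    rw [hσ, ← map_pow, ← map_pow, ← hk, pow_orderOf_eq_one, map_one, map_one])
  classical
  -- The part `x` of `f` on `A` still commutes with `c ^ 2`, as `A` is stable under `σ ^ 2`.
  set x : MonoidAlgebra R G := .ofCoeff (f.coeff.filter (· ∈ A)) with hx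
  have hxA (g : G) : x.coeff g = if g ∈ A then f.coeff g else 0 := by
    rw [hx, MonoidAlgebra.coeff_ofCoeff, Finsupp.filter_apply]
  have hxcomm : γ' * x * γ * γ = γ * x := by
    have h1 : γ' * (γ' * x * γ) * γ = x := by
      ext g
      rw [hconj, hconj, hxA, hxA, hfσσ]
      simp only [hAA]
    calc γ' * x * γ * γ = γ * (γ' * (γ' * x * γ) * γ) := by
          simp only [← mul_assoc, hγγ', one_mul]
      _ = γ * x := by rw [h1]
  have heven (g : G) : (2 : R) ∣ (f + x + γ' * x * γ).coeff g := by
    simp only [MonoidAlgebra.coeff_add, Finsupp.add_apply, hconj, hxA]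
    by_cases hg : σ g = g
    · rw [hg]
      have := hfix g hg
      split_ifs
      · exact dvd_add (dvd_add this this) this
      · simpa using this
    · by_cases hgA : g ∈ A
      · have h1 : σ g ∉ A := fun h ↦ (hA g hg).mp h hgA
        simp [hgA, h1, ← two_mul]
      · have h1 : σ g ∈ A := (hA g hg).mpr hgA
        simpa [hgA, h1] using hfσ g
  choose y hy using heven
  have hy' : f + x + γ' * x * γ = 2 * .ofCoeff (Finsupp.equivFunOnFinite.symm y) := by
    ext g
    rw [hy, coeff_two_mul]
    rfl
  obtain ⟨v, hv⟩ := isUnit_one_add_smul_of_mem_jacobson hJ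
    ((.ofCoeff (Finsupp.equivFunOnFinite.symm y) + γ' * x * γ * f : MonoidAlgebra R G))
  have hv' : (v : MonoidAlgebra R G) = 1 + f + x + γ' * x * γ * w := by
    rw [hv, two_smul, ← two_mul, mul_add, ← hy', hw]
    noncomm_ring
  refine ⟨v, ?_⟩
  rw [mul_assoc, eq_inv_mul_iff_mul_eq]
  refine Units.ext ?_
  rw [Units.val_mul, Units.val_mul, hu, hv']
  have h1 : (1 + f) * (γ * w) = γ * (1 + f) := by
    refine htwo ?_
    calc 2 * ((1 + f) * (γ * w)) = γ * w + w * γ * w := by rw [hw]; noncomm_ring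
      _ = 2 * (γ * (1 + f)) := by rw [hwγw, hw]; noncomm_ring
  calc (1 + f + x + γ' * x * γ * w) * (γ * w)
      = (1 + f) * (γ * w) + x * γ * w + γ' * x * γ * (w * γ * w) := by
        simp only [add_mul, mul_assoc]
    _ = γ * (1 + f) + γ * γ' * x * γ * w + γ * x := by
        rw [h1, hwγw, hxcomm, hγγ', one_mul]
    _ = γ * (1 + f + x + γ' * x * γ * w) := by
        simp only [mul_add, mul_assoc]; abel

end

end PadicGroupRing

theorem mainTheorem4
    {K : Type*} [Field K] [Algebra ℚ_[2] K] [FiniteDimensional ℚ_[2] K]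
    [Algebra ℤ_[2] K] [IsScalarTower ℤ_[2] ℚ_[2] K]
    {R : Type*} [CommRing R] [Algebra R K] [IsIntegralClosure R ℤ_[2] K]
    {G : Type*} [Group G] [Finite G]
    (c : G) (hc : PadicGroupRing.IsPElement 2 c)
    (u : (MonoidAlgebra R G)ˣ) (huV : u ∈ PadicGroupRing.normalizedUnits R G)
    (hu : PadicGroupRing.IsPElement 2 u)
    (hsq : PadicGroupRing.groupUnit R c ^ 2 = u ^ 2)
    (f : MonoidAlgebra R G)
    (hcu : (((PadicGroupRing.groupUnit R c)⁻¹ * u : (MonoidAlgebra R G)ˣ) : MonoidAlgebra R G)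
      = 1 + 2 * f)
    (hf : ∃ a : MonoidAlgebra R G, ∃ t ∈ PadicGroupRing.spanOf R (PadicGroupRing.involutions G),
      ∃ r : R, f = 2 * a + t + algebraMap R (MonoidAlgebra R G) r) :
    ∃ v : (MonoidAlgebra R G)ˣ, u = v⁻¹ * PadicGroupRing.groupUnit R c * v := by
  obtain ⟨a, t, ht, r, hatr⟩ := hf
  have hinj := IsIntegralClosure.algebraMap_injective R ℤ_[2] K
  have : IsDomain R := hinj.isDomain (algebraMap R K)
  have : CharZero K := charZero_of_injective_algebraMap (algebraMap ℚ_[2] K).injective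
  have h2 : (2 : R) ≠ 0 := fun h ↦ two_ne_zero (α := K) (by
    rw [← map_ofNat (algebraMap R K) 2, h, map_zero])
  exact PadicGroupRing.exists_conj_of_inv_mul_eq_one_add_two_mul h2
    (two_mem_jacobson_of_isIntegralClosure (K := K)) hc huV hsq hcu
    fun g hg ↦ PadicGroupRing.two_dvd_coeff_of_sq_ne_one ht hatr hg
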